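/- Let $n\ge 1$, let $S^{n-1}$ be the unit sphere and $B^n$ the closed unit ball of $\mathbb{R}^n$, and let $du$ be the spherical measure on $S^{n-1}$. Let $\mathcal{K}^n_{(o)}$ be the set of compact convex sets in $\mathbb{R}^n$ with the origin in their interior. For $K\in\mathcal{K}^n_{(o)}$ write $h_K(u)=\max_{x\in K}\langle x,u\rangle$ and $\rho_K(u)=\max\{r\ge 0: ru\in K\}$ for $u\in S^{n-1}$, and $K^\circ=\{x\in\mathbb{R}^n:\langle x,y\rangle\le 1\text{ for all }y\in K\}$. Let $\mu=\sum_{i=1}^m\lambda_i\delta_{u_i}$ with $\lambda_i>0$ and $u_i\in S^{n-1}$ be a discrete measure that is not concentrated on any closed hemisphere. Let $\varphi:(0,\infty)\to(0,\infty)$ be continuous and strictly increasing with $\varphi(0+)=0$, $\varphi(1)=1$ and $\varphi(\infty)=\infty$. Let $G:(0,\infty)\times S^{n-1}\to(0,\infty)$ be continuous and such that, for every $u\in S^{n-1}$, $t\mapsto G(t,u)$ is strictly increasing with $\lim_{t\to0^+}G(t,u)=0$ and $\lim_{t\to\infty}G(t,u)=\infty$. Suppose that for some $q\ge n-1$, $$\inf\Big\{\frac{G(t,u)}{t^q}:\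 t\ge 1,\ u\in S^{n-1}\Big\}>0 .$$ For $K\in\mathcal{K}^n_{(o)}$ put $$\widetilde V_G(K)=\int_{S^{n-1}}G(\rho_K(u),u)\,du,\qquad \widehat V_G(K)=\inf\Big\{\eta>0:\ \int_{S^{n-1}}G\Big(\frac{\rho_K(u)}{\eta},u\Big)du\le 1\Big\},$$ and let $\widetilde{\mathcal B}=\{Q\in\mathcal{K}^n_{(o)}:\widetilde V_G(Q^\circ)=\widetilde V_G(B^n)\}$ and $\widehat{\mathcal B}=\{Q\in\mathcal{K}^n_{(o)}:\widehat V_G(Q^\circ)=\widehat V_G(B^n)\}$. Say that $u_1,\dots,u_m$ are the unit normals of the faces of a polytope $P$ if each $u_i$ is an outer unit normal of some (nonempty, possibly lower-dimensional) face of $P$, $P=\bigcap_{i=1}^m\{x:\langle x,u_i\rangle\le h_P(u_i)\}$, and the outer unit normal of every $(n-1)$-dimensional face of $P$ is one of $u_1,\dots,u_m$. Then: i) There is a polytope $\widetilde P\in\widetilde{\mathcal B}$ with $u_1,\dots,u_m$ being the unit normals of its faces such that $$\int_{S^{n-1}}\varphi(h_{\widetilde P})\,d\mu=\sum_{i=1}^m\lambda_i\varphi(h_{\widetilde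 P}(u_i))=\min\Big\{\int_{S^{n-1}}\varphi(h_Q)\,d\mu:\ Q\in\widetilde{\mathcal B}\Big\}.$$ ii) There is a polytope $\widehat P\in\widehat{\mathcal B}$ with $u_1,\dots,u_m$ being the unit normals of its faces such that $$\int_{S^{n-1}}\varphi(h_{\widehat P})\,d\mu=\sum_{i=1}^m\lambda_i\varphi(h_{\widehat P}(u_i))=\min\Big\{\int_{S^{n-1}}\varphi(h_Q)\,d\mu:\ Q\in\widehat{\mathcal B}\Big\}.$$ -/

import Mathlib

open MeasureTheory Set Filter Topology

noncomputable section

namespace DualPolarOrlicz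

/-- The `n`-dimensional Euclidean space. -/
abbrev Euc (n : ℕ) : Type := EuclideanSpace ℝ (Fin n)

/-- The unit sphere of the `n`-dimensional Euclidean space. -/
abbrev Sph (n : ℕ) : Type := Metric.sphere (0 : Euc n) 1

/-- The spherical (surface) measure of the unit sphere; it is normalized such that the volume of
a body star-shaped about the origin is `n⁻¹ * ∫ u, ρ u ^ n`. -/
abbrev sphMeasure (n : ℕ) : Measure (Sph n) := (volume : Measure (Euc n)).toSphere

/-- Convex bodies with the origin in their interior. -/
def IsBody {n : ℕ} (K : Set (Euc n)) : Prop :=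
  IsCompact K ∧ Convex ℝ K ∧ (0 : Euc n) ∈ interior K

/-- The support function `h_K (u) = max {⟪x, u⟫ : x ∈ K}`. -/
def supportFn {n : ℕ} (K : Set (Euc n)) (u : Sph n) : ℝ :=
  sSup ((fun x : Euc n => inner ℝ x (u : Euc n)) '' K)

/-- The radial function `ρ_K (u) = max {r ≥ 0 : r u ∈ K}`. -/
def radialFn {n : ℕ} (K : Set (Euc n)) (u : Sph n) : ℝ :=
  sSup {r : ℝ | 0 ≤ r ∧ r • (u : Euc n) ∈ K}

/-- The polar body `K° = {x : ⟪x, y⟫ ≤ 1 for all y ∈ K}`. -/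
def polarBody {n : ℕ} (K : Set (Euc n)) : Set (Euc n) :=
  {x | ∀ y ∈ K, inner ℝ x y ≤ 1}

/-- The closed unit ball. -/
def unitBall (n : ℕ) : Set (Euc n) := Metric.closedBall 0 1

/-- The class of increasing functions `φ : (0, ∞) → (0, ∞)`; the values of `φ` outside `(0, ∞)`
are irrelevant. -/
structure ClassI (φ : ℝ → ℝ) : Prop where
  pos : ∀ t, 0 < t → 0 < φ t
  continuousOn : ContinuousOn φ (Ioi 0)
  strictMonoOn : StrictMonoOn φ (Ioi 0)
  tendsto_zero : Tendsto φ (𝓝[>] 0) (𝓝 0)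
  map_one : φ 1 = 1
  tendsto_atTop : Tendsto φ atTop atTop

/-- The class of functions `G : (0, ∞) × S^{n-1} → (0, ∞)` that are jointly continuous and, in
the first variable, strictly increasing from `0` to `∞`; the values of `G` outside
`(0, ∞) × S^{n-1}` are irrelevant. -/
structure ClassGI {n : ℕ} (G : ℝ → Sph n → ℝ) : Prop where
  pos : ∀ t u, 0 < t → 0 < G t u
  continuousOn : ContinuousOn (fun p : ℝ × Sph n => G p.1 p.2) (Ioi 0 ×ˢ univ)
  strictMonoOn : ∀ u, StrictMonoOn (fun t => G t u) (Ioi 0)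
  tendsto_zero : ∀ u, Tendsto (fun t => G t u) (𝓝[>] 0) (𝓝 0)
  tendsto_atTop : ∀ u, Tendsto (fun t => G t u) atTop atTop

/-- The infimum of `G t u / t ^ q` over `t ≥ 1` and `u ∈ S^{n-1}` is positive. -/
def HasGrowth {n : ℕ} (G : ℝ → Sph n → ℝ) (q : ℝ) : Prop :=
  ∃ c : ℝ, 0 < c ∧ ∀ t u, 1 ≤ t → c ≤ G t u / t ^ q

/-- The general dual volume. -/
def dualVol {n : ℕ} (G : ℝ → Sph n → ℝ) (K : Set (Euc n)) : ℝ :=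
  ∫ u, G (radialFn K u) u ∂(sphMeasure n)

/-- The homogeneous general dual volume (for `G` increasing in the first variable). -/
def homDualVol {n : ℕ} (G : ℝ → Sph n → ℝ) (K : Set (Euc n)) : ℝ :=
  sInf {η : ℝ | 0 < η ∧ ∫ u, G (radialFn K u / η) u ∂(sphMeasure n) ≤ 1}

/-- The bodies whose polar has the general dual volume of the unit ball. -/
def bodiesTilde {n : ℕ} (G : ℝ → Sph n → ℝ) : Set (Set (Euc n)) :=
  {Q | IsBody Q ∧ dualVol G (polarBody Q) = dualVol G (unitBall n)}

/-- The bodies whose polar has the homogeneous general dual volume of the unit ball. -/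
def bodiesHat {n : ℕ} (G : ℝ → Sph n → ℝ) : Set (Set (Euc n)) :=
  {Q | IsBody Q ∧ homDualVol G (polarBody Q) = homDualVol G (unitBall n)}

/-- The discrete measure `∑ i, c i • δ_{u i}`. -/
def discreteMeasure {n m : ℕ} (c : Fin m → ℝ) (u : Fin m → Sph n) : Measure (Sph n) :=
  ∑ i, ENNReal.ofReal (c i) • Measure.dirac (u i)

/-- No closed hemisphere `{u : 0 ≤ ⟪u, v⟫}` carries all of `μ`. -/
def NotConcentrated {n : ℕ} (μ : Measure (Sph n)) : Prop :=
  ∀ v : Sph n, μ {u : Sph n | 0 ≤ inner ℝ (u : Euc n) (v : Euc n)}ᶜ ≠ 0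

/-- The functional `Q ↦ ∫ φ (h_Q (u)) dμ(u)` that is to be minimized. -/
def energy {n : ℕ} (φ : ℝ → ℝ) (μ : Measure (Sph n)) (Q : Set (Euc n)) : ℝ :=
  ∫ u, φ (supportFn Q u) ∂μ

/-- A polytope is the convex hull of finitely many points. -/
def IsPolytope {n : ℕ} (P : Set (Euc n)) : Prop :=
  ∃ S : Set (Euc n), S.Finite ∧ P = convexHull ℝ S

/-- The face of `P` with outer unit normal `v`, i.e. the intersection of `P` with its supporting
hyperplane in the direction `v`; it may have any dimension. -/
def faceOf {n : ℕ} (P : Set (Euc n)) (v : Sph n) : Set (Euc n) :=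
  {x | x ∈ P ∧ inner ℝ x (v : Euc n) = supportFn P v}

/-- `v` is the outer unit normal of an `(n-1)`-dimensional face of `P`. -/
def IsFacetNormal {n : ℕ} (P : Set (Euc n)) (v : Sph n) : Prop :=
  (faceOf P v).Nonempty ∧ Module.finrank ℝ (vectorSpan ℝ (faceOf P v)) + 1 = n

/-- `u 1, …, u m` are the unit normals of the faces that bound `P`: each `u i` is an outer normal
of a face, `P` is the intersection of the supporting half-spaces with these normals, and every
facet of `P` has one of them as its normal. -/
def HasFaceNormals {n m : ℕ} (P : Set (Euc n)) (u : Fin m → Sph n) : Prop :=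
  (∀ i, (faceOf P (u i)).Nonempty) ∧
  P = ⋂ i, {x : Euc n | inner ℝ x (u i : Euc n) ≤ supportFn P (u i)} ∧
  ∀ v : Sph n, IsFacetNormal P v → v ∈ range u

end DualPolarOrlicz

end

open MeasureTheory Set Filter Topology

noncomputable section

namespace DualPolarOrlicz

section SupportFunction

variable {n : ℕ} {K L : Set (Euc n)}

lemma bddAbove_inner_image (hK : IsCompact K) (w : Euc n) :
    BddAbove ((fun x : Euc n => inner ℝ x w) '' K) :=
  (hK.image (by fun_prop)).bddAbove

lemma inner_le_supportFn (hK : IsCompact K) {x : Euc n} (hx : x ∈ K) (w : Sph n) :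
    inner ℝ x (w : Euc n) ≤ supportFn K w :=
  le_csSup (bddAbove_inner_image hK w) ⟨x, hx, rfl⟩

lemma supportFn_le (hne : K.Nonempty) {w : Sph n} {a : ℝ}
    (h : ∀ x ∈ K, inner ℝ x (w : Euc n) ≤ a) : supportFn K w ≤ a :=
  csSup_le (hne.image _) (by rintro _ ⟨x, hx, rfl⟩; exact h x hx)

lemma exists_inner_eq_supportFn (hK : IsCompact K) (hne : K.Nonempty) (w : Sph n) :
    ∃ x ∈ K, inner ℝ x (w : Euc n) = supportFn K w :=
  (hK.image (f := fun x : Euc n => inner ℝ x (w : Euc n)) (by fun_prop)).sSup_mem (hne.image _)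

lemma continuous_supportFn (hK : IsCompact K) : Continuous (supportFn K) :=
  hK.continuous_sSup (f := fun (w : Sph n) (x : Euc n) => inner ℝ x (w : Euc n)) (by fun_prop)

lemma supportFn_mono (hL : IsCompact L) (hne : K.Nonempty) (h : K ⊆ L) (w : Sph n) :
    supportFn K w ≤ supportFn L w :=
  supportFn_le hne fun _ hx => inner_le_supportFn hL (h hx) w

lemma IsBody.zero_mem (hK : IsBody K) : (0 : Euc n) ∈ K := interior_subset hK.2.2

lemma nonempty_sph (hn : 1 ≤ n) : Nonempty (Sph n) := by
  have : Nonempty (Fin n) := ⟨⟨0, hn⟩⟩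
  exact (NormedSpace.sphere_nonempty.2 zero_le_one).to_subtype

lemma norm_coe_sph (w : Sph n) : ‖(w : Euc n)‖ = 1 := by simp

lemma inner_self_sph (w : Sph n) : inner ℝ (w : Euc n) (w : Euc n) = 1 := by
  rw [real_inner_self_eq_norm_sq, norm_coe_sph]; norm_num

/-- An interior point of a compact set is strictly below each supporting hyperplane. -/
lemma inner_lt_supportFn_of_mem_interior (hK : IsCompact K) {x : Euc n} (hx : x ∈ interior K)
    (w : Sph n) : inner ℝ x (w : Euc n) < supportFn K w := by
  obtain ⟨ε, hε, hb⟩ := Metric.isOpen_iff.1 isOpen_interior x hx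
  have hmem : x + (ε / 2) • (w : Euc n) ∈ K := by
    refine interior_subset (hb ?_)
    rw [Metric.mem_ball, dist_eq_norm, add_sub_cancel_left, norm_smul, norm_coe_sph,
      Real.norm_of_nonneg (by positivity)]
    linarith
  have := inner_le_supportFn hK hmem w
  rw [inner_add_left, real_inner_smul_left, inner_self_sph] at this
  linarith

lemma IsBody.supportFn_pos (hK : IsBody K) (w : Sph n) : 0 < supportFn K w := by
  simpa using inner_lt_supportFn_of_mem_interior hK.1 hK.2.2 w

lemma smul_mem_polarBody_iff (hK : IsBody K) (w : Sph n) {r : ℝ} (hr : 0 ≤ r) :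
    r • (w : Euc n) ∈ polarBody K ↔ r ≤ (supportFn K w)⁻¹ := by
  have hp := hK.supportFn_pos w
  rw [← one_div, le_div_iff₀ hp]
  constructor
  · intro h
    obtain ⟨x, hx, hxe⟩ := exists_inner_eq_supportFn hK.1 ⟨0, hK.zero_mem⟩ w
    have := h x hx
    rwa [real_inner_smul_left, real_inner_comm, hxe] at this
  · intro h y hy
    rw [real_inner_smul_left, real_inner_comm]
    exact (mul_le_mul_of_nonneg_left (inner_le_supportFn hK.1 hy w) hr).trans h

lemma radialFn_polarBody (hK : IsBody K) (w : Sph n) :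
    radialFn (polarBody K) w = (supportFn K w)⁻¹ := by
  have hp := inv_pos.2 (hK.supportFn_pos w)
  have : {r : ℝ | 0 ≤ r ∧ r • (w : Euc n) ∈ polarBody K} = Icc 0 (supportFn K w)⁻¹ := by
    ext r
    exact and_congr_right fun hr => smul_mem_polarBody_iff hK w hr
  rw [radialFn, this, csSup_Icc hp.le]

lemma radialFn_unitBall (w : Sph n) : radialFn (unitBall n) w = 1 := by
  have : {r : ℝ | 0 ≤ r ∧ r • (w : Euc n) ∈ unitBall n} = Icc 0 1 := by
    ext r
    refine and_congr_right fun hr => ?_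
    rw [unitBall, mem_closedBall_zero_iff, norm_smul, norm_coe_sph, Real.norm_of_nonneg hr,
      mul_one]
  rw [radialFn, this, csSup_Icc zero_le_one]

end SupportFunction

section HalfspaceIntersection

variable {n m : ℕ}

/-- The intersection of the half-spaces `⟪x, u i⟫ ≤ z i`. -/
def hPoly (u : Fin m → Sph n) (z : Fin m → ℝ) : Set (Euc n) :=
  {x | ∀ i, inner ℝ x (u i : Euc n) ≤ z i}

variable {u : Fin m → Sph n} {z z' : Fin m → ℝ}

lemma hPoly_mono (h : ∀ i, z i ≤ z' i) : hPoly u z ⊆ hPoly u z' :=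
  fun _ hx i => (hx i).trans (h i)

lemma isClosed_hPoly : IsClosed (hPoly u z) := by
  simp only [hPoly, ofPred_forall]
  exact isClosed_iInter fun i => isClosed_le (by fun_prop) continuous_const

lemma convex_hPoly : Convex ℝ (hPoly u z) := by
  intro x hx y hy a b ha hb hab i
  rw [inner_add_left, real_inner_smul_left, real_inner_smul_left]
  have h1 := mul_le_mul_of_nonneg_left (hx i) ha
  have h2 := mul_le_mul_of_nonneg_left (hy i) hb
  calc _ ≤ a * z i + b * z i := add_le_add h1 h2
    _ = z i := by rw [← add_mul, hab, one_mul]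

lemma mem_interior_hPoly {x : Euc n} (h : ∀ i, inner ℝ x (u i : Euc n) < z i) :
    x ∈ interior (hPoly u z) := by
  have ho : IsOpen {x : Euc n | ∀ i, inner ℝ x (u i : Euc n) < z i} := by
    simp only [ofPred_forall]
    exact isOpen_iInter_of_finite fun i => isOpen_lt (by fun_prop) continuous_const
  exact interior_maximal (fun y hy i => (hy i).le) ho h

end HalfspaceIntersection

section Polytope

variable {n m : ℕ} {u : Fin m → Sph n} {z : Fin m → ℝ}

lemma isCompact_hPoly (hu : ∀ v : Sph n, ∃ i, 0 < inner ℝ (v : Euc n) (u i : Euc n)) :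
    IsCompact (hPoly u z) := by
  have hcover : (univ : Set (Sph n)) ⊆
      ⋃ k : ℕ, {v : Sph n | ∃ i, 1 / ((k : ℝ) + 1) < inner ℝ (v : Euc n) (u i : Euc n)} := by
    intro v _
    obtain ⟨i, hi⟩ := hu v
    obtain ⟨k, hk⟩ := exists_nat_one_div_lt hi
    exact mem_iUnion.2 ⟨k, i, hk⟩
  obtain ⟨k, hk⟩ := isCompact_univ.elim_directed_cover _ (fun k => by
      simp only [ofPred_exists]
      exact isOpen_iUnion fun i => isOpen_lt continuous_const (by fun_prop)) hcover
    (Monotone.directed_le fun a b hab v ⟨i, hi⟩ =>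
      ⟨i, (one_div_le_one_div_of_le (by positivity) (by gcongr)).trans_lt hi⟩)
  have hsub : hPoly u z ⊆ Metric.closedBall 0 ((k + 1) * ∑ i, |z i|) := by
    intro x hx
    rw [mem_closedBall_zero_iff]
    by_cases hx0 : x = 0
    · rw [hx0, norm_zero]; positivity
    have hxn : 0 < ‖x‖ := norm_pos_iff.2 hx0
    obtain ⟨i, hi⟩ := hk (mem_univ (⟨‖x‖⁻¹ • x, by
      rw [mem_sphere_zero_iff_norm, norm_smul, norm_inv, norm_norm, inv_mul_cancel₀ hxn.ne']⟩ :
        Sph n))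
    rw [real_inner_smul_left, one_div, inv_mul_eq_div, lt_div_iff₀ hxn, inv_mul_lt_iff₀
      (by positivity)] at hi
    refine hi.le.trans (mul_le_mul_of_nonneg_left ?_ (by positivity))
    exact (hx i).trans ((le_abs_self _).trans
      (Finset.single_le_sum (f := fun i => |z i|) (fun _ _ => abs_nonneg _) (Finset.mem_univ i)))
  exact (isCompact_closedBall _ _).of_isClosed_subset isClosed_hPoly hsub

lemma isBody_hPoly (hu : ∀ v : Sph n, ∃ i, 0 < inner ℝ (v : Euc n) (u i : Euc n))
    (hz : ∀ i, 0 < z i) : IsBody (hPoly u z) :=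
  ⟨isCompact_hPoly hu, convex_hPoly, mem_interior_hPoly (by simpa using hz)⟩

/-- An extreme point is determined by the set of its active constraints. -/
lemma finite_extremePoints_hPoly : ((hPoly u z).extremePoints ℝ).Finite := by
  classical
  let act : Euc n → Finset (Fin m) := fun x => {i | inner ℝ x (u i : Euc n) = z i}
  refine Set.Finite.of_finite_image (f := act) (Set.toFinite _) ?_
  intro x hx y hy hxy
  have hact : ∀ i, inner ℝ x (u i : Euc n) = z i → inner ℝ y (u i : Euc n) = z i := by
    intro i hi
    have : i ∈ act x := by simp [act, hi]
    rw [hxy] at this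
    simpa [act] using this
  have hsmall : ∀ᶠ t : ℝ in 𝓝 0, x + t • (y - x) ∈ hPoly u z := by
    simp only [hPoly, mem_ofPred_eq, eventually_all]
    intro i
    rcases (hx.1 i).eq_or_lt with h | h
    · refine Eventually.of_forall fun t => ?_
      rw [inner_add_left, real_inner_smul_left, inner_sub_left, h, hact i h]
      simp
    · have hc : Continuous fun t : ℝ => inner ℝ (x + t • (y - x)) (u i : Euc n) := by fun_prop
      have := hc.continuousAt.eventually_lt (continuousAt_const (y := z i)) (x₀ := 0) (by simpa)
      exact this.mono fun t ht => ht.le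
  have hneg : ∀ᶠ t : ℝ in 𝓝 0, x + (-t) • (y - x) ∈ hPoly u z := by
    have : Tendsto (fun t : ℝ => -t) (𝓝 0) (𝓝 0) := by simpa using (continuous_neg.tendsto (0 : ℝ))
    exact this.eventually hsmall
  obtain ⟨t, ⟨ht1, ht2⟩, ht0 : 0 < t⟩ :=
    (((hsmall.and hneg).filter_mono nhdsWithin_le_nhds).and
      (self_mem_nhdsWithin (s := Ioi (0 : ℝ)))).exists
  have hseg : x ∈ openSegment ℝ (x + t • (y - x)) (x + (-t) • (y - x)) :=
    ⟨1 / 2, 1 / 2, by norm_num, by norm_num, by norm_num, by module⟩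
  have := (mem_extremePoints.1 hx).2 _ ht1 _ ht2 hseg
  have h0 : t • (y - x) = 0 := by simpa using this.1
  rcases smul_eq_zero.1 h0 with h | h
  · exact absurd h ht0.ne'
  · exact (sub_eq_zero.1 h).symm

lemma isPolytope_hPoly (hu : ∀ v : Sph n, ∃ i, 0 < inner ℝ (v : Euc n) (u i : Euc n)) :
    IsPolytope (hPoly u z) := by
  refine ⟨_, finite_extremePoints_hPoly (u := u) (z := z), ?_⟩
  rw [← (finite_extremePoints_hPoly.isCompact_convexHull (𝕜 := ℝ)).isClosed.closure_eq,
    closure_convexHull_extremePoints (isCompact_hPoly hu) convex_hPoly]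

/-- Every facet lies in one of the hyperplanes that bound the polytope. -/
lemma faceOf_hPoly_subset (hu : ∀ v : Sph n, ∃ i, 0 < inner ℝ (v : Euc n) (u i : Euc n))
    (hz : ∀ i, 0 < z i) (v : Sph n) :
    ∃ i, ∀ x ∈ faceOf (hPoly u z) v, inner ℝ x (u i : Euc n) = z i := by
  by_contra! hcon
  choose x hxF hxi using hcon
  have hm : 0 < (m : ℝ) := by
    obtain ⟨i, -⟩ := hu v
    exact_mod_cast i.pos
  have hw : ∑ _j : Fin m, (m : ℝ)⁻¹ = 1 := by simp [hm.ne']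
  have hmean : ∀ w : Euc n, inner ℝ (∑ j, (m : ℝ)⁻¹ • x j) w = ∑ j, (m : ℝ)⁻¹ * inner ℝ (x j) w :=
    fun w => by simp_rw [sum_inner, real_inner_smul_left]
  have hint : ∑ j, (m : ℝ)⁻¹ • x j ∈ interior (hPoly u z) := by
    refine mem_interior_hPoly fun i => ?_
    calc _ = ∑ j, (m : ℝ)⁻¹ * inner ℝ (x j) (u i : Euc n) := hmean _
      _ < ∑ _j : Fin m, (m : ℝ)⁻¹ * z i := by
        refine Finset.sum_lt_sum (fun j _ => ?_) ⟨i, Finset.mem_univ i, ?_⟩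
        · exact mul_le_mul_of_nonneg_left ((hxF j).1 i) (by positivity)
        · exact mul_lt_mul_of_pos_left (lt_of_le_of_ne ((hxF i).1 i) (hxi i)) (by positivity)
      _ = z i := by rw [← Finset.sum_mul, hw, one_mul]
  refine (inner_lt_supportFn_of_mem_interior (isBody_hPoly hu hz).1 hint v).ne ?_
  simp_rw [hmean, fun j => (hxF j).2, ← Finset.sum_mul, hw, one_mul]

lemma hasFaceNormals_hPoly (hu : ∀ v : Sph n, ∃ i, 0 < inner ℝ (v : Euc n) (u i : Euc n))
    (hz : ∀ i, 0 < z i) (hsupp : ∀ i, supportFn (hPoly u z) (u i) = z i) :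
    HasFaceNormals (hPoly u z) u := by
  have hB := isBody_hPoly hu hz
  refine ⟨fun i => ?_, ?_, fun v hv => ?_⟩
  · obtain ⟨x, hx, hxe⟩ := exists_inner_eq_supportFn hB.1 ⟨0, hB.zero_mem⟩ (u i)
    exact ⟨x, hx, hxe⟩
  · simp_rw [hsupp]
    ext x
    simp [hPoly]
  obtain ⟨⟨x, hx⟩, hdim⟩ := hv
  obtain ⟨i, hi⟩ := faceOf_hPoly_subset hu hz v
  set W := vectorSpan ℝ (faceOf (hPoly u z) v) with hW
  have horth : ∀ (w : Euc n) (a : ℝ), (∀ y ∈ faceOf (hPoly u z) v, inner ℝ y w = a) →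
      W ≤ (Submodule.span ℝ {w})ᗮ := by
    intro w a h
    rw [hW, vectorSpan, Submodule.span_le]
    rintro _ ⟨y, hy, y', hy', rfl⟩
    rw [SetLike.mem_coe, Submodule.mem_orthogonal_singleton_iff_inner_left]
    simp [inner_sub_left, h y hy, h y' hy']
  have hWv : W = (Submodule.span ℝ {(v : Euc n)})ᗮ := by
    refine Submodule.eq_of_le_of_finrank_eq (horth _ _ fun y hy => hy.2) ?_
    have h1 := Submodule.finrank_add_finrank_orthogonal (Submodule.span ℝ {(v : Euc n)})
    have hv0 : (v : Euc n) ≠ 0 := fun h => by simpa [h] using norm_coe_sph v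
    rw [finrank_span_singleton hv0, finrank_euclideanSpace_fin] at h1
    omega
  have hui : (u i : Euc n) ∈ Submodule.span ℝ {(v : Euc n)} := by
    rw [← Submodule.orthogonal_orthogonal (Submodule.span ℝ {(v : Euc n)}), ← hWv,
      Submodule.mem_orthogonal]
    intro y hy
    exact (Submodule.mem_orthogonal_singleton_iff_inner_left).1 (horth _ _ hi hy)
  obtain ⟨a, ha⟩ := Submodule.mem_span_singleton.1 hui
  have hapos : 0 < a := by
    have h1 := hi x hx
    rw [← ha, real_inner_smul_right, hx.2] at h1
    exact (pos_iff_pos_of_mul_pos (h1 ▸ hz i)).2 (hB.supportFn_pos v)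
  have ha1 : a = 1 := by
    have := congrArg norm ha
    rwa [norm_smul, norm_coe_sph, norm_coe_sph, mul_one, Real.norm_of_nonneg hapos.le] at this
  refine ⟨i, Subtype.ext ?_⟩
  rw [← ha, ha1, one_smul]

lemma NotConcentrated.exists_inner_pos {c : Fin m → ℝ}
    (h : NotConcentrated (discreteMeasure c u)) (v : Sph n) :
    ∃ i, 0 < inner ℝ (v : Euc n) (u i : Euc n) := by
  by_contra! hcon
  refine h (-v) ?_
  simp only [discreteMeasure, Measure.coe_finsetSum, Finset.sum_apply, Measure.smul_apply]
  refine Finset.sum_eq_zero fun i _ => ?_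
  have : u i ∉ {w : Sph n | 0 ≤ inner ℝ (w : Euc n) ((-v : Sph n) : Euc n)}ᶜ := by
    simpa [real_inner_comm] using hcon i
  rw [Measure.dirac_apply, indicator_of_notMem this, smul_zero]

lemma energy_discreteMeasure {c : Fin m → ℝ} (hc : ∀ i, 0 < c i) (φ : ℝ → ℝ) (Q : Set (Euc n)) :
    energy φ (discreteMeasure c u) Q = ∑ i, c i * φ (supportFn Q (u i)) := by
  rw [energy, discreteMeasure, integral_finsetSum_measure]
  · refine Finset.sum_congr rfl fun i _ => ?_
    rw [integral_smul_measure, integral_dirac, ENNReal.toReal_ofReal (hc i).le, smul_eq_mul]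
  · intro i _
    exact (integrable_dirac (by simp)).smul_measure ENNReal.ofReal_ne_top

end Polytope

section AxisDistance

variable {n : ℕ}

/-- The distance of `w` to the line spanned by `v`. -/
def axisDist (v w : Sph n) : ℝ :=
  ‖(w : Euc n) - (inner ℝ (w : Euc n) (v : Euc n) : ℝ) • (v : Euc n)‖

lemma axisDist_nonneg (v w : Sph n) : 0 ≤ axisDist v w := norm_nonneg _

lemma axisDist_self (v : Sph n) : axisDist v v = 0 := by
  simp [axisDist]

lemma continuous_axisDist (v : Sph n) : Continuous (axisDist v) := by
  unfold axisDist; fun_prop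

lemma eq_of_axisDist_eq_zero {v w : Sph n} (hpos : 0 < inner ℝ (w : Euc n) (v : Euc n))
    (h : axisDist v w = 0) : w = v := by
  rw [axisDist, norm_eq_zero, sub_eq_zero] at h
  have h1 := congrArg norm h
  rw [norm_smul, norm_coe_sph, norm_coe_sph, mul_one, Real.norm_of_nonneg hpos.le] at h1
  rw [← h1, one_smul] at h
  exact Subtype.ext h

/-- The open half sphere around `v`, without `v`. -/
def puncturedHalf (v : Sph n) : Set (Sph n) :=
  {w | 0 < inner ℝ (w : Euc n) (v : Euc n) ∧ 0 < axisDist v w}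

lemma measurableSet_puncturedHalf (v : Sph n) : MeasurableSet (puncturedHalf v) :=
  ((isOpen_lt (g := fun w : Sph n => inner ℝ (w : Euc n) (v : Euc n)) continuous_const
    (by fun_prop)).inter (isOpen_lt continuous_const (continuous_axisDist v))).measurableSet

/-- The distance from `y` to the line spanned by `v` is at most that to any point on the line. -/
lemma norm_sub_inner_smul_le (v : Sph n) (y : Euc n) (a : ℝ) :
    ‖y - (inner ℝ y (v : Euc n) : ℝ) • (v : Euc n)‖ ≤ ‖y - a • (v : Euc n)‖ := by
  refine le_of_sq_le_sq ?_ (norm_nonneg _)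
  have h1 := inner_self_sph v
  set b : ℝ := inner ℝ y (v : Euc n) with hb
  have key : ∀ c : ℝ, ‖y - c • (v : Euc n)‖ ^ 2 = ‖y‖ ^ 2 - 2 * c * b + c ^ 2 := by
    intro c
    rw [norm_sub_sq_real, real_inner_smul_right, norm_smul, norm_coe_sph, mul_one,
      Real.norm_eq_abs, sq_abs]
    ring
  rw [key, key]
  nlinarith [sq_nonneg (a - b)]

/-- A ray through a ball of radius `1/2` around a point of the axis. -/
lemma of_smul_mem_ball {v w : Sph n} {r : ℝ} (hr : 0 < r) {k N : ℕ} (hk : k < N)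
    (h : r • (w : Euc n) ∈ Metric.ball (((k : ℝ) + 1) • (v : Euc n)) (1 / 2)) :
    0 < inner ℝ (w : Euc n) (v : Euc n) ∧ r < N + 1 ∧ r * axisDist v w < 1 := by
  rw [mem_ball_iff_norm] at h
  have hk' : (k : ℝ) + 1 ≤ N := by exact_mod_cast hk
  refine ⟨?_, ?_, ?_⟩
  · have h1 := real_inner_le_norm (((k : ℝ) + 1) • (v : Euc n) - r • (w : Euc n)) (v : Euc n)
    rw [norm_coe_sph, mul_one, norm_sub_rev, inner_sub_left, real_inner_smul_left,
      real_inner_smul_left, inner_self_sph] at h1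
    have : 0 < r * inner ℝ (w : Euc n) (v : Euc n) := by
      have : (0 : ℝ) ≤ k := k.cast_nonneg
      linarith
    exact (pos_iff_pos_of_mul_pos this).1 hr
  · have h1 := norm_le_norm_add_norm_sub' (r • (w : Euc n)) (((k : ℝ) + 1) • (v : Euc n))
    rw [norm_smul, norm_smul, norm_coe_sph, norm_coe_sph, Real.norm_of_nonneg hr.le,
      Real.norm_of_nonneg (by positivity)] at h1
    linarith
  · have h1 := norm_sub_inner_smul_le v (r • (w : Euc n)) ((k : ℝ) + 1)
    rw [real_inner_smul_left, mul_smul, ← smul_sub, norm_smul, Real.norm_of_nonneg hr.le] at h1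
    rw [axisDist]
    linarith

/-- A chain of disjoint balls along the axis. -/
def ballChain (v : Sph n) (N : ℕ) : Set (Euc n) :=
  ⋃ k ∈ Finset.range N, Metric.ball (((k : ℝ) + 1) • (v : Euc n)) (1 / 2)

lemma volume_ballChain (v : Sph n) (N : ℕ) :
    volume (ballChain v N) = N * volume (Metric.ball (0 : Euc n) (1 / 2)) := by
  rw [ballChain, measure_biUnion_finset]
  · simp [Measure.addHaar_ball_center]
  · intro i _ j _ hij
    refine Metric.ball_disjoint_ball ?_
    rw [dist_eq_norm, ← sub_smul, norm_smul, norm_coe_sph, mul_one, add_sub_add_right_eq_sub,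
      Real.norm_eq_abs]
    have : (1 : ℤ) ≤ |(i : ℤ) - j| := Int.one_le_abs (sub_ne_zero.2 (by exact_mod_cast hij))
    have : (1 : ℝ) ≤ |(i : ℝ) - j| := by exact_mod_cast this
    linarith
  · exact fun _ _ => measurableSet_ball

lemma volume_ballChain_le (hn : 1 ≤ n) (v : Sph n) (hv : sphMeasure n {v} = 0) (N : ℕ) :
    volume (ballChain v N) ≤ ∫⁻ w in puncturedHalf v,
      ENNReal.ofReal (min ((N : ℝ) + 1) (axisDist v w)⁻¹ ^ n / n) ∂(sphMeasure n) := by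
  have hU : MeasurableSet (ballChain v N) :=
    Finset.measurableSet_biUnion _ fun _ _ => measurableSet_ball
  have h0 : (0 : Euc n) ∉ ballChain v N := by
    simp only [ballChain, mem_iUnion, not_exists]
    intro k _ h
    rw [mem_ball_iff_norm, zero_sub, norm_neg, norm_smul, norm_coe_sph, mul_one,
      Real.norm_of_nonneg (by positivity)] at h
    have : (0 : ℝ) ≤ k := k.cast_nonneg
    linarith
  have hmp := (volume : Measure (Euc n)).measurePreserving_homeomorphUnitSphereProd
  set S : Set (Sph n × Ioi (0 : ℝ)) := {p | (p.2 : ℝ) • (p.1 : Euc n) ∈ ballChain v N} with hS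
  have hSm : MeasurableSet S := by
    have : Measurable fun p : Sph n × Ioi (0 : ℝ) => (p.2 : ℝ) • (p.1 : Euc n) :=
      Continuous.measurable (by fun_prop)
    exact this hU
  have hpre : homeomorphUnitSphereProd (Euc n) ⁻¹' S = Subtype.val ⁻¹' ballChain v N := by
    ext x
    have : ‖(x : Euc n)‖ ≠ 0 := norm_ne_zero_iff.2 x.2
    simp [S, smul_smul, this]
  have hvol : volume (ballChain v N) =
      ((volume : Measure (Euc n)).toSphere.prod (Measure.volumeIoiPow (n - 1))) S := by
    have := hmp.measure_preimage hSm.nullMeasurableSet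
    rw [finrank_euclideanSpace_fin] at this
    rw [← this, hpre, comap_subtype_coe_apply (measurableSet_singleton _).compl,
      Subtype.image_preimage_coe, inter_eq_self_of_subset_right]
    exact fun x hx hx0 => h0 (hx0 ▸ hx)
  rw [hvol, Measure.prod_apply hSm,
    ← lintegral_indicator (measurableSet_puncturedHalf v)]
  refine lintegral_mono_ae ?_
  have hne : ∀ᵐ w ∂(sphMeasure n), w ≠ v := by
    rw [ae_iff]; simpa using hv
  filter_upwards [hne] with w hw
  by_cases hwA : w ∈ puncturedHalf v
  · rw [indicator_of_mem hwA]
    have hmin : 0 < min ((N : ℝ) + 1) (axisDist v w)⁻¹ := by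
      have := hwA.2
      positivity
    have hsub : Prod.mk w ⁻¹' S ⊆ Iio ⟨min ((N : ℝ) + 1) (axisDist v w)⁻¹, hmin⟩ := by
      intro r hr
      simp only [S, ballChain, mem_preimage, mem_ofPred_eq, mem_iUnion, Finset.mem_range] at hr
      obtain ⟨k, hk, hr⟩ := hr
      have := of_smul_mem_ball r.2 hk hr
      rw [mem_Iio, ← Subtype.coe_lt_coe]
      exact lt_min this.2.1 (by rw [← one_div, lt_div_iff₀ hwA.2]; exact this.2.2)
    refine (measure_mono hsub).trans ?_
    rw [Measure.volumeIoiPow_apply_Iio, Nat.sub_add_cancel hn, Nat.cast_sub hn]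
    simp
  · rw [indicator_of_notMem hwA]
    have : Prod.mk w ⁻¹' S = ∅ := by
      rw [eq_empty_iff_forall_notMem]
      intro r hr
      simp only [S, ballChain, mem_preimage, mem_ofPred_eq, mem_iUnion, Finset.mem_range] at hr
      obtain ⟨k, hk, hr⟩ := hr
      have := of_smul_mem_ball r.2 hk hr
      refine hwA ⟨this.1, (axisDist_nonneg v w).lt_of_ne fun h => hw ?_⟩
      exact eq_of_axisDist_eq_zero this.1 h.symm
    rw [this, measure_empty]

/-- The function `w ↦ (axisDist v w) ^ (1 - n)` is not integrable near `v`. -/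
lemma lintegral_inv_axisDist_pow (hn : 1 ≤ n) (v : Sph n) (hv : sphMeasure n {v} = 0) :
    ∫⁻ w in puncturedHalf v, ENNReal.ofReal ((axisDist v w)⁻¹ ^ (n - 1)) ∂(sphMeasure n) = ⊤ := by
  by_contra hfin
  have hn0 : (0 : ℝ) < n := by exact_mod_cast hn
  have hn1 : (1 : ℝ) ≤ n := by exact_mod_cast hn
  set F : ℕ → Sph n → ENNReal := fun N w =>
    ENNReal.ofReal (min (((N + 1 : ℕ) : ℝ) + 1) (axisDist v w)⁻¹ ^ n / n / (N + 1 : ℕ)) with hF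
  have hmeas : Measurable (axisDist v) := (continuous_axisDist v).measurable
  have hlim : Tendsto (fun N => ∫⁻ w in puncturedHalf v, F N w ∂(sphMeasure n)) atTop
      (𝓝 (∫⁻ w in puncturedHalf v, 0 ∂(sphMeasure n))) := by
    refine tendsto_lintegral_of_dominated_convergence
      (fun w => ENNReal.ofReal 2 * ENNReal.ofReal ((axisDist v w)⁻¹ ^ (n - 1)))
      (fun N => by fun_prop) ?_ ?_ ?_
    · intro N
      filter_upwards [ae_restrict_mem (measurableSet_puncturedHalf v)] with w hw
      rw [← ENNReal.ofReal_mul zero_le_two]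
      refine ENNReal.ofReal_le_ofReal ?_
      have hd : 0 < (axisDist v w)⁻¹ := inv_pos.2 hw.2
      have hN : (1 : ℝ) ≤ (N + 1 : ℕ) := by exact_mod_cast Nat.succ_le_succ (Nat.zero_le N)
      rw [div_div, div_le_iff₀ (by positivity)]
      calc min (((N + 1 : ℕ) : ℝ) + 1) (axisDist v w)⁻¹ ^ n
          = min (((N + 1 : ℕ) : ℝ) + 1) (axisDist v w)⁻¹ ^ (n - 1) *
            min (((N + 1 : ℕ) : ℝ) + 1) (axisDist v w)⁻¹ := by
              rw [← pow_succ, Nat.sub_add_cancel hn]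
        _ ≤ (axisDist v w)⁻¹ ^ (n - 1) * (((N + 1 : ℕ) : ℝ) + 1) := by
              gcongr
              · exact min_le_right _ _
              · exact min_le_left _ _
        _ ≤ (axisDist v w)⁻¹ ^ (n - 1) * (2 * (n * (N + 1 : ℕ))) := by
              gcongr
              nlinarith
        _ = _ := by ring
    · rw [lintegral_const_mul _ (by fun_prop)]
      exact ENNReal.mul_ne_top ENNReal.ofReal_ne_top hfin
    · filter_upwards [ae_restrict_mem (measurableSet_puncturedHalf v)] with w hw
      have hd : 0 < (axisDist v w)⁻¹ := inv_pos.2 hw.2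
      rw [← ENNReal.ofReal_zero]
      refine ENNReal.tendsto_ofReal ?_
      have hup : Tendsto (fun N : ℕ => (axisDist v w)⁻¹ ^ n / n / (N + 1 : ℕ)) atTop (𝓝 0) :=
        (tendsto_const_div_atTop_nhds_zero_nat _).comp (tendsto_add_atTop_nat 1)
      refine squeeze_zero (fun N => by positivity) (fun N => ?_) hup
      gcongr
      exact min_le_right _ _
  rw [lintegral_zero] at hlim
  have hge : ∀ N, volume (Metric.ball (0 : Euc n) (1 / 2)) ≤
      ∫⁻ w in puncturedHalf v, F N w ∂(sphMeasure n) := by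
    intro N
    have h1 := volume_ballChain_le hn v hv (N + 1)
    have hN : (0 : ℝ) < (N + 1 : ℕ) := by exact_mod_cast Nat.succ_pos N
    have hF' : ∀ w, F N w = ENNReal.ofReal
        (min (((N + 1 : ℕ) : ℝ) + 1) (axisDist v w)⁻¹ ^ n / n) / ((N + 1 : ℕ) : ENNReal) := by
      intro w
      rw [hF, ← ENNReal.ofReal_natCast (N + 1), ← ENNReal.ofReal_div_of_pos hN]
    simp_rw [hF', fun x : ENNReal => div_eq_mul_inv x ((N + 1 : ℕ) : ENNReal)]
    rw [lintegral_mul_const _ (by fun_prop), ← div_eq_mul_inv, ENNReal.le_div_iff_mul_le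
      (Or.inl (by exact_mod_cast N.succ_ne_zero)) (Or.inl (ENNReal.natCast_ne_top _)), mul_comm,
      ← volume_ballChain v (N + 1)]
    exact h1
  have := ge_of_tendsto' hlim hge
  exact (Metric.measure_ball_pos volume (0 : Euc n) (by norm_num : (0 : ℝ) < 1 / 2)).ne'
    (le_antisymm this zero_le)

end AxisDistance

section BlowUp

variable {n : ℕ} {G : ℝ → Sph n → ℝ}

lemma ClassGI.continuous_comp (hG : ClassGI G) {X : Type*} [TopologicalSpace X] {f : X → ℝ}
    {g : X → Sph n} (hf : Continuous f) (hg : Continuous g) (hpos : ∀ x, 0 < f x) :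
    Continuous fun x => G (f x) (g x) :=
  hG.continuousOn.comp_continuous (f := fun x => (f x, g x)) (hf.prodMk hg)
    fun x => ⟨hpos x, mem_univ _⟩

lemma ClassGI.mono (hG : ClassGI G) (w : Sph n) {s t : ℝ} (hs : 0 < s) (hst : s ≤ t) :
    G s w ≤ G t w :=
  (hG.strictMonoOn w).monotoneOn hs (hs.trans_le hst) hst

/-- A growth condition of order `n - 1` forces the dual volumes of convex hulls of a ball and a
point at distance `δ⁻¹` to be unbounded as `δ → 0`. -/
lemma exists_lt_lintegral (hn : 1 ≤ n) (hG : ClassGI G)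
    (hgr : ∃ c T : ℝ, 0 < c ∧ 0 < T ∧ ∀ t u, T ≤ t → c * t ^ (n - 1) ≤ G t u)
    (v : Sph n) {R : ℝ} (hR : 0 < R) (V : ℝ) :
    ∃ δ : ℝ, 0 < δ ∧ ENNReal.ofReal V <
      ∫⁻ w in {w : Sph n | 0 < inner ℝ (w : Euc n) (v : Euc n)},
        ENNReal.ofReal (G (δ + R * axisDist v w)⁻¹ w) ∂(sphMeasure n) := by
  by_contra! hcon
  set A : Set (Sph n) := {w : Sph n | 0 < inner ℝ (w : Euc n) (v : Euc n)} with hA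
  have hAm : MeasurableSet A := (isOpen_lt continuous_const (by fun_prop)).measurableSet
  have hvA : v ∈ A := by rw [hA, mem_ofPred_eq, inner_self_sph]; exact one_pos
  set F : ℕ → Sph n → ENNReal := fun k w =>
    ENNReal.ofReal (G (1 / ((k : ℝ) + 1) + R * axisDist v w)⁻¹ w) with hF
  have hpos : ∀ (k : ℕ) (w : Sph n), 0 < 1 / ((k : ℝ) + 1) + R * axisDist v w := fun k w => by
    have := axisDist_nonneg v w
    positivity
  have hFm : ∀ k, Measurable (F k) := fun k => by
    refine (hG.continuous_comp ?_ continuous_id fun w => inv_pos.2 (hpos k w)).measurable.ennreal_ofReal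
    exact (continuous_const.add (continuous_const.mul (continuous_axisDist v))).inv₀
      fun w => (hpos k w).ne'
  have hfatou : ∫⁻ w in A, liminf (fun k => F k w) atTop ∂(sphMeasure n) ≤ ENNReal.ofReal V := by
    refine (lintegral_liminf_le hFm).trans ?_
    refine liminf_le_of_frequently_le' (Eventually.of_forall fun k => ?_).frequently
    exact hcon _ (by positivity)
  have hδ : Tendsto (fun k : ℕ => 1 / ((k : ℝ) + 1)) atTop (𝓝 0) :=
    tendsto_one_div_add_atTop_nhds_zero_nat
  have hvnull : sphMeasure n {v} = 0 := by
    have hae := ae_lt_top (Measurable.liminf hFm) (hfatou.trans_lt ENNReal.ofReal_lt_top).ne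
    rw [ae_restrict_iff' hAm] at hae
    refine measure_mono_null (singleton_subset_iff.2 ?_) hae
    have hlim : Tendsto (fun k => F k v) atTop (𝓝 ⊤) := by
      refine ENNReal.tendsto_ofReal_atTop.comp ((hG.tendsto_atTop v).comp ?_)
      simp only [axisDist_self, mul_zero, add_zero, one_div, inv_inv]
      exact tendsto_atTop_add_const_right _ _ tendsto_natCast_atTop_atTop
    simp only [mem_compl_iff, mem_ofPred_eq, Classical.not_imp]
    exact ⟨hvA, by rw [hlim.liminf_eq]; simp⟩
  have hsub : puncturedHalf v ⊆ A := fun w hw => hw.1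
  have hlimit : ∀ w ∈ puncturedHalf v, liminf (fun k => F k w) atTop =
      ENNReal.ofReal (G (R * axisDist v w)⁻¹ w) := by
    intro w hw
    have hp : 0 < R * axisDist v w := mul_pos hR hw.2
    refine (ENNReal.tendsto_ofReal ?_).liminf_eq
    have hc : ContinuousAt (fun t => G t w) (R * axisDist v w)⁻¹ := by
      have h1 : ContinuousAt (fun p : ℝ × Sph n => G p.1 p.2) ((R * axisDist v w)⁻¹, w) :=
        hG.continuousOn.continuousAt ((isOpen_Ioi.prod isOpen_univ).mem_nhds
          ⟨inv_pos.2 hp, mem_univ _⟩)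
      exact h1.comp (f := fun t : ℝ => (t, w)) (by fun_prop)
    refine hc.tendsto.comp (Tendsto.inv₀ ?_ hp.ne')
    simpa using hδ.add_const (R * axisDist v w)
  have hint : ∫⁻ w in puncturedHalf v, ENNReal.ofReal (G (R * axisDist v w)⁻¹ w) ∂(sphMeasure n)
      < ⊤ := by
    rw [← setLIntegral_congr_fun (measurableSet_puncturedHalf v) hlimit]
    exact ((lintegral_mono_set hsub).trans hfatou).trans_lt ENNReal.ofReal_lt_top
  obtain ⟨c, T, hc, hT, hgr⟩ := hgr
  refine (lintegral_inv_axisDist_pow hn v hvnull).not_lt ?_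
  calc ∫⁻ w in puncturedHalf v, ENNReal.ofReal ((axisDist v w)⁻¹ ^ (n - 1)) ∂(sphMeasure n)
      ≤ ∫⁻ w in puncturedHalf v, (ENNReal.ofReal ((R * T) ^ (n - 1)) +
          ENNReal.ofReal (R ^ (n - 1) / c) * ENNReal.ofReal (G (R * axisDist v w)⁻¹ w))
          ∂(sphMeasure n) := by
        refine setLIntegral_mono' (measurableSet_puncturedHalf v) fun w hw => ?_
        have hd := inv_pos.2 hw.2
        have hp : 0 < (R * axisDist v w)⁻¹ := inv_pos.2 (mul_pos hR hw.2)
        have hGp := hG.pos _ w hp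
        have heq : (axisDist v w)⁻¹ = R * (R * axisDist v w)⁻¹ := by
          rw [mul_inv, mul_inv_cancel_left₀ hR.ne']
        rcases le_total T (R * axisDist v w)⁻¹ with h | h
        · refine le_trans ?_ le_add_self
          rw [← ENNReal.ofReal_mul (by positivity), heq]
          refine ENNReal.ofReal_le_ofReal ?_
          rw [mul_pow, div_mul_eq_mul_div, mul_div_assoc]
          gcongr
          rw [le_div_iff₀ hc, mul_comm]
          exact hgr _ w h
        · refine le_trans (ENNReal.ofReal_le_ofReal ?_) le_self_add
          rw [heq]
          gcongr
    _ < ⊤ := by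
        rw [lintegral_add_left measurable_const, lintegral_const_mul' _ _ ENNReal.ofReal_ne_top,
          ENNReal.add_lt_top]
        refine ⟨?_, ENNReal.mul_lt_top ENNReal.ofReal_lt_top hint⟩
        rw [lintegral_const]
        exact ENNReal.mul_lt_top ENNReal.ofReal_lt_top (measure_lt_top _ _)

end BlowUp

section DualVolume

variable {n : ℕ} {G : ℝ → Sph n → ℝ} {ρ ρ' : Sph n → ℝ}

lemma ClassGI.integrable (hG : ClassGI G) (hρ : Continuous ρ) (hpos : ∀ w, 0 < ρ w) :
    Integrable (fun w => G (ρ w) w) (sphMeasure n) :=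
  (hG.continuous_comp hρ continuous_id hpos).integrable_of_hasCompactSupport
    (HasCompactSupport.of_compactSpace _)

lemma ClassGI.integral_mono (hG : ClassGI G) (hρ : Continuous ρ) (hpos : ∀ w, 0 < ρ w)
    (hρ' : Continuous ρ') (hle : ∀ w, ρ w ≤ ρ' w) :
    ∫ w, G (ρ w) w ∂(sphMeasure n) ≤ ∫ w, G (ρ' w) w ∂(sphMeasure n) :=
  MeasureTheory.integral_mono (hG.integrable hρ hpos)
    (hG.integrable hρ' fun w => (hpos w).trans_le (hle w))
    fun w => hG.mono w (hpos w) (hle w)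

lemma ClassGI.continuousOn_integral_mul (hG : ClassGI G) (hρ : Continuous ρ)
    (hpos : ∀ w, 0 < ρ w) :
    ContinuousOn (fun s => ∫ w, G (s * ρ w) w ∂(sphMeasure n)) (Ioi 0) := by
  have := isOpen_Ioi.locallyCompactSpace (s := Ioi (0 : ℝ))
  rw [continuousOn_iff_continuous_domRestrict]
  have h := continuous_parametric_integral_of_continuous (μ := sphMeasure n)
    (f := fun (s : Ioi (0 : ℝ)) w => G (s * ρ w) w)
    (hG.continuous_comp (f := fun p : Ioi (0 : ℝ) × Sph n => (p.1 : ℝ) * ρ p.2) (g := Prod.snd)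
      (by fun_prop) (by fun_prop) fun p => mul_pos p.1.2 (hpos p.2)) isCompact_univ
  simp only [Measure.restrict_univ] at h
  exact h

lemma ClassGI.exists_forall_lt (hG : ClassGI G) (M : ℝ) : ∃ t, 0 < t ∧ ∀ w, M < G t w := by
  have hcover : (univ : Set (Sph n)) ⊆ ⋃ k : ℕ, {w : Sph n | M < G ((k : ℝ) + 1) w} := by
    intro w _
    have ht : Tendsto (fun k : ℕ => G ((k : ℝ) + 1) w) atTop atTop :=
      (hG.tendsto_atTop w).comp
        (tendsto_atTop_add_const_right _ _ tendsto_natCast_atTop_atTop)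
    obtain ⟨k, hk⟩ := (ht.eventually_gt_atTop M).exists
    exact mem_iUnion.2 ⟨k, hk⟩
  obtain ⟨k, hk⟩ := isCompact_univ.elim_directed_cover _ (fun k : ℕ =>
      isOpen_lt continuous_const
        (hG.continuous_comp continuous_const continuous_id fun _ => by positivity)) hcover
    (Monotone.directed_le fun a b hab w (hw : M < _) =>
      hw.trans_le (hG.mono w (by positivity) (by gcongr)))
  exact ⟨k + 1, by positivity, fun w => hk (mem_univ w)⟩

lemma ClassGI.exists_forall_gt (hG : ClassGI G) {ε : ℝ} (hε : 0 < ε) :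
    ∃ t, 0 < t ∧ ∀ w, G t w < ε := by
  have hcover : (univ : Set (Sph n)) ⊆ ⋃ k : ℕ, {w : Sph n | G (1 / ((k : ℝ) + 1)) w < ε} := by
    intro w _
    have ht : Tendsto (fun k : ℕ => G (1 / ((k : ℝ) + 1)) w) atTop (𝓝 0) :=
      (hG.tendsto_zero w).comp (tendsto_nhdsWithin_iff.2
        ⟨tendsto_one_div_add_atTop_nhds_zero_nat,
          Eventually.of_forall fun k => mem_Ioi.2 (by positivity)⟩)
    obtain ⟨k, hk⟩ := (ht.eventually_lt_const hε).exists
    exact mem_iUnion.2 ⟨k, hk⟩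
  obtain ⟨k, hk⟩ := isCompact_univ.elim_directed_cover _ (fun k : ℕ =>
      isOpen_lt (hG.continuous_comp (f := fun _ => 1 / ((k : ℝ) + 1)) continuous_const
        continuous_id fun _ => by positivity) continuous_const) hcover
    (Monotone.directed_le fun a b hab w (hw : _ < ε) =>
      (hG.mono w (by positivity) (one_div_le_one_div_of_le (by positivity) (by gcongr))).trans_lt hw)
  exact ⟨1 / (k + 1), by positivity, fun w => hk (mem_univ w)⟩

lemma sphMeasure_real_univ_pos (hn : 1 ≤ n) : 0 < (sphMeasure n).real univ := by
  have : Nonempty (Fin n) := ⟨⟨0, hn⟩⟩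
  have : NeZero (sphMeasure n) := ⟨Measure.toSphere_ne_zero _⟩
  exact measureReal_univ_pos

/-- Exactly one dilate of `ρ` has integral one, and it bounds those with integral at most one. -/
lemma ClassGI.exists_integral_mul_le_one_iff (hn : 1 ≤ n) (hG : ClassGI G) (hρ : Continuous ρ)
    (hpos : ∀ w, 0 < ρ w) :
    ∃ s, 0 < s ∧ ∀ t, 0 < t → (∫ w, G (t * ρ w) w ∂(sphMeasure n) ≤ 1 ↔ t ≤ s) ∧
      (∫ w, G (t * ρ w) w ∂(sphMeasure n) = 1 ↔ t = s) := by
  have hM := sphMeasure_real_univ_pos hn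
  set M := (sphMeasure n).real univ
  have := nonempty_sph hn
  set J : ℝ → ℝ := fun s => ∫ w, G (s * ρ w) w ∂(sphMeasure n) with hJ
  have hJc : ContinuousOn J (Ioi 0) := hG.continuousOn_integral_mul hρ hpos
  have hint : ∀ s, 0 < s → Integrable (fun w => G (s * ρ w) w) (sphMeasure n) := fun s hs =>
    hG.integrable (continuous_const.mul hρ) fun w => mul_pos hs (hpos w)
  have hJm : StrictMonoOn J (Ioi 0) := by
    intro s hs t ht hst
    have hlt : ∀ w, 0 < G (t * ρ w) w - G (s * ρ w) w := fun w =>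
      sub_pos.2 (hG.strictMonoOn w (mul_pos hs (hpos w)) (mul_pos ht (hpos w))
        (mul_lt_mul_of_pos_right hst (hpos w)))
    rw [← sub_pos, ← integral_sub (hint t ht) (hint s hs),
      integral_pos_iff_support_of_nonneg (fun w => (hlt w).le) ((hint t ht).sub (hint s hs)),
      Function.support_eq_univ fun w => (hlt w).ne']
    exact (ENNReal.toReal_pos_iff.1 hM).1
  obtain ⟨w₀, -, hw₀⟩ := isCompact_univ.exists_isMinOn univ_nonempty hρ.continuousOn
  obtain ⟨w₁, -, hw₁⟩ := isCompact_univ.exists_isMaxOn univ_nonempty hρ.continuousOn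
  have hlo : ∃ a, 0 < a ∧ J a ≤ 1 := by
    obtain ⟨t, ht, hlt⟩ := hG.exists_forall_gt (inv_pos.2 hM)
    refine ⟨t / ρ w₁, div_pos ht (hpos _), ?_⟩
    calc J (t / ρ w₁) ≤ ∫ _w, M⁻¹ ∂(sphMeasure n) := by
          refine MeasureTheory.integral_mono (hint _ (div_pos ht (hpos _))) (integrable_const _)
            fun w => ?_
          refine (hG.mono w (mul_pos (div_pos ht (hpos _)) (hpos w)) ?_).trans (hlt w).le
          rw [div_mul_eq_mul_div, div_le_iff₀ (hpos _)]
          exact mul_le_mul_of_nonneg_left (hw₁ (mem_univ w)) ht.le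
      _ = 1 := by rw [integral_const, smul_eq_mul]; exact mul_inv_cancel₀ hM.ne'
  have hhi : ∃ b, 0 < b ∧ 1 ≤ J b := by
    obtain ⟨t, ht, hlt⟩ := hG.exists_forall_lt M⁻¹
    refine ⟨t / ρ w₀, div_pos ht (hpos _), ?_⟩
    calc 1 = ∫ _w, M⁻¹ ∂(sphMeasure n) := by
          rw [integral_const, smul_eq_mul]; exact (mul_inv_cancel₀ hM.ne').symm
      _ ≤ J (t / ρ w₀) := by
          refine MeasureTheory.integral_mono (integrable_const _) (hint _ (div_pos ht (hpos _)))
            fun w => ?_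
          refine (hlt w).le.trans (hG.mono w ht ?_)
          rw [div_mul_eq_mul_div, le_div_iff₀ (hpos _)]
          exact mul_le_mul_of_nonneg_left (hw₀ (mem_univ w)) ht.le
  obtain ⟨a, ha, hJa⟩ := hlo
  obtain ⟨b, hb, hJb⟩ := hhi
  obtain ⟨s, hs, hJs⟩ := isPreconnected_Ioi.intermediate_value₂ (mem_Ioi.2 ha) (mem_Ioi.2 hb) hJc
    continuousOn_const hJa hJb
  exact ⟨s, hs, fun t ht => ⟨by
    change J t ≤ 1 ↔ _
    rw [← hJs]; exact hJm.le_iff_le ht hs, by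
    change J t = 1 ↔ _
    rw [← hJs]; exact hJm.injOn.eq_iff ht hs⟩⟩

end DualVolume

section PolarDualVolume

variable {n m : ℕ} {G : ℝ → Sph n → ℝ} {K L : Set (Euc n)} {u : Fin m → Sph n} {z : Fin m → ℝ}

lemma IsBody.continuous_inv_supportFn (hK : IsBody K) :
    Continuous fun w => (supportFn K w)⁻¹ :=
  (continuous_supportFn hK.1).inv₀ fun w => (hK.supportFn_pos w).ne'

lemma IsBody.inv_supportFn_pos (hK : IsBody K) (w : Sph n) : 0 < (supportFn K w)⁻¹ :=
  inv_pos.2 (hK.supportFn_pos w)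

lemma dualVol_polarBody (hK : IsBody K) :
    dualVol G (polarBody K) = ∫ w, G (supportFn K w)⁻¹ w ∂(sphMeasure n) := by
  simp_rw [dualVol, radialFn_polarBody hK]

lemma dualVol_unitBall : dualVol G (unitBall n) = ∫ w, G 1 w ∂(sphMeasure n) := by
  simp_rw [dualVol, radialFn_unitBall]

lemma dualVol_polarBody_anti (hG : ClassGI G) (hK : IsBody K) (hL : IsBody L) (h : K ⊆ L) :
    dualVol G (polarBody L) ≤ dualVol G (polarBody K) := by
  rw [dualVol_polarBody hK, dualVol_polarBody hL]
  exact hG.integral_mono hL.continuous_inv_supportFn hL.inv_supportFn_pos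
    hK.continuous_inv_supportFn fun w => inv_anti₀ (hK.supportFn_pos w)
      (supportFn_mono hL.1 ⟨0, hK.zero_mem⟩ h w)

lemma supportFn_hPoly_smul
    (hu : ∀ v : Sph n, ∃ i, 0 < inner ℝ (v : Euc n) (u i : Euc n))
    (hz : ∀ i, 0 < z i) {t : ℝ} (ht : 0 < t) (w : Sph n) :
    supportFn (hPoly u (t • z)) w = t * supportFn (hPoly u z) w := by
  have hB := isBody_hPoly hu hz
  have hB' := isBody_hPoly (z := t • z) hu fun i => mul_pos ht (hz i)
  apply le_antisymm
  · refine supportFn_le ⟨0, hB'.zero_mem⟩ fun x hx => ?_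
    have hmem : t⁻¹ • x ∈ hPoly u z := fun i => by
      rw [real_inner_smul_left, inv_mul_le_iff₀ ht]
      exact hx i
    have := inner_le_supportFn hB.1 hmem w
    rwa [real_inner_smul_left, inv_mul_le_iff₀ ht] at this
  · rw [← le_div_iff₀' ht]
    refine supportFn_le ⟨0, hB.zero_mem⟩ fun x hx => ?_
    have hmem : t • x ∈ hPoly u (t • z) := fun i => by
      rw [real_inner_smul_left]
      exact mul_le_mul_of_nonneg_left (hx i) ht.le
    have := inner_le_supportFn hB'.1 hmem w
    rwa [real_inner_smul_left, ← le_div_iff₀' ht] at this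

lemma dualVol_polarBody_hPoly_smul
    (hu : ∀ v : Sph n, ∃ i, 0 < inner ℝ (v : Euc n) (u i : Euc n))
    (hz : ∀ i, 0 < z i) {t : ℝ} (ht : 0 < t) :
    dualVol G (polarBody (hPoly u (t • z))) =
      ∫ w, G (t⁻¹ * (supportFn (hPoly u z) w)⁻¹) w ∂(sphMeasure n) := by
  rw [dualVol_polarBody (isBody_hPoly (z := t • z) hu fun i => mul_pos ht (hz i))]
  simp_rw [supportFn_hPoly_smul hu hz ht, mul_inv]

lemma tendsto_dualVol_polarBody_hPoly_smul
    (hu : ∀ v : Sph n, ∃ i, 0 < inner ℝ (v : Euc n) (u i : Euc n))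
    (hG : ClassGI G) (hz : ∀ i, 0 < z i) :
    Tendsto (fun t : ℝ => dualVol G (polarBody (hPoly u (t • z)))) (𝓝 1)
      (𝓝 (dualVol G (polarBody (hPoly u z)))) := by
  have hB := isBody_hPoly hu hz
  have h := (hG.continuousOn_integral_mul hB.continuous_inv_supportFn
    hB.inv_supportFn_pos).continuousAt (Ioi_mem_nhds one_pos)
  have hinv : Tendsto (fun t : ℝ => t⁻¹) (𝓝 1) (𝓝 1) := by
    simpa using tendsto_inv₀ (one_ne_zero (α := ℝ))
  have h2 := h.tendsto.comp hinv
  simp only [one_mul] at h2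
  rw [← dualVol_polarBody hB] at h2
  refine h2.congr' ?_
  filter_upwards [Ioi_mem_nhds (zero_lt_one (α := ℝ))] with t ht
  exact (dualVol_polarBody_hPoly_smul hu hz ht).symm

/-- The distances of the bounding hyperplanes of a polytope from the origin are bounded below in
terms of the dual volume of the polar body and of an upper bound of these distances. -/
lemma exists_forall_lt_of_dualVol_le
    (hu : ∀ v : Sph n, ∃ i, 0 < inner ℝ (v : Euc n) (u i : Euc n))
    (hn : 1 ≤ n) (hG : ClassGI G)
    (hgr : ∃ c T : ℝ, 0 < c ∧ 0 < T ∧ ∀ t u, T ≤ t → c * t ^ (n - 1) ≤ G t u) (R V : ℝ)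
    (i : Fin m) :
    ∃ δ : ℝ, 0 < δ ∧ ∀ z : Fin m → ℝ, (∀ j, 0 < z j ∧ z j ≤ R) →
      dualVol G (polarBody (hPoly u z)) ≤ V → δ < z i := by
  obtain ⟨B, hB0, hB⟩ := (isCompact_hPoly (z := fun _ => R) hu).isBounded.exists_pos_norm_le
  obtain ⟨δ, hδ, hlt⟩ := exists_lt_lintegral hn hG hgr (u i) hB0 V
  refine ⟨δ, hδ, fun z hz hV => ?_⟩
  by_contra! hzi
  refine hlt.not_ge ?_
  have hbody := isBody_hPoly hu fun j => (hz j).1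
  have hsupp : ∀ w : Sph n, 0 < inner ℝ (w : Euc n) (u i : Euc n) →
      supportFn (hPoly u z) w ≤ δ + B * axisDist (u i) w := by
    intro w hw
    refine supportFn_le ⟨0, hbody.zero_mem⟩ fun x hx => ?_
    have ha1 : inner ℝ (w : Euc n) (u i : Euc n) ≤ 1 := by
      simpa [norm_coe_sph] using real_inner_le_norm (w : Euc n) (u i : Euc n)
    have hx1 : inner ℝ x (u i : Euc n) ≤ δ := (hx i).trans hzi
    have hx2 := real_inner_le_norm x
      ((w : Euc n) - (inner ℝ (w : Euc n) (u i : Euc n) : ℝ) • (u i : Euc n))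
    rw [inner_sub_right, real_inner_smul_right] at hx2
    have hx3 : ‖x‖ * axisDist (u i) w ≤ B * axisDist (u i) w :=
      mul_le_mul_of_nonneg_right (hB x (hPoly_mono (fun j => (hz j).2) hx)) (axisDist_nonneg _ _)
    rw [axisDist] at hx3 ⊢
    nlinarith [mul_le_mul_of_nonneg_left hx1 hw.le]
  calc _ ≤ ∫⁻ w in {w : Sph n | 0 < inner ℝ (w : Euc n) (u i : Euc n)},
        ENNReal.ofReal (G (supportFn (hPoly u z) w)⁻¹ w) ∂(sphMeasure n) := by
        refine setLIntegral_mono' (isOpen_lt continuous_const (by fun_prop)).measurableSet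
          fun w hw => ENNReal.ofReal_le_ofReal ?_
        have := axisDist_nonneg (u i) w
        exact hG.mono w (by positivity) (inv_anti₀ (hbody.supportFn_pos w) (hsupp w hw))
    _ ≤ ∫⁻ w, ENNReal.ofReal (G (supportFn (hPoly u z) w)⁻¹ w) ∂(sphMeasure n) :=
        setLIntegral_le_lintegral _ _
    _ = ENNReal.ofReal (dualVol G (polarBody (hPoly u z))) := by
        rw [dualVol_polarBody hbody, ofReal_integral_eq_lintegral_ofReal
          (hG.integrable hbody.continuous_inv_supportFn hbody.inv_supportFn_pos)
          (Eventually.of_forall fun w => (hG.pos _ w (hbody.inv_supportFn_pos w)).le)]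
    _ ≤ ENNReal.ofReal V := ENNReal.ofReal_le_ofReal hV

lemma isCompact_setOf_dualVol_le
    (hu : ∀ v : Sph n, ∃ i, 0 < inner ℝ (v : Euc n) (u i : Euc n))
    (hG : ClassGI G) {δ : Fin m → ℝ} (hδ : ∀ i, 0 < δ i) (R V : ℝ) :
    IsCompact {z : Fin m → ℝ | z ∈ Icc δ (fun _ => R) ∧
      dualVol G (polarBody (hPoly u z)) ≤ V} := by
  refine (isCompact_Icc (a := δ) (b := fun _ => R)).of_isClosed_subset ?_ fun z hz => hz.1
  refine isClosed_of_closure_subset fun z hz => ?_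
  have hzI : z ∈ Icc δ (fun _ => R) := closure_minimal (fun z hz => hz.1) isClosed_Icc hz
  have hz0 : ∀ i, 0 < z i := fun i => (hδ i).trans_le (hzI.1 i)
  refine ⟨hzI, le_of_tendsto ((tendsto_dualVol_polarBody_hPoly_smul hu hG hz0).mono_left
    (nhdsWithin_le_nhds (s := Ioi 1))) ?_⟩
  filter_upwards [self_mem_nhdsWithin] with t ht
  rw [mem_Ioi] at ht
  have hopen : {z' : Fin m → ℝ | ∀ i, z' i < t * z i} ∈ 𝓝 z := by
    refine IsOpen.mem_nhds ?_ fun i => by nlinarith [hz0 i]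
    simp only [ofPred_forall]
    exact isOpen_iInter_of_finite fun i => isOpen_lt (continuous_apply i) continuous_const
  obtain ⟨z', hz'1, hz'2⟩ := mem_closure_iff_nhds.1 hz _ hopen
  have hz'0 : ∀ i, 0 < z' i := fun i => (hδ i).trans_le (hz'2.1.1 i)
  exact (dualVol_polarBody_anti hG (isBody_hPoly hu hz'0)
    (isBody_hPoly hu fun i => mul_pos (one_pos.trans ht) (hz0 i))
    (hPoly_mono fun i => (hz'1 i).le)).trans hz'2.2

end PolarDualVolume

section Minimizer

variable {n m : ℕ} {G : ℝ → Sph n → ℝ} {u : Fin m → Sph n} {c : Fin m → ℝ} {φ : ℝ → ℝ}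

/-- Among the polytopes with the given normals whose polar bodies have at most the dual volume of
the unit ball, there is one of minimal energy. -/
lemma exists_minimal_distances (hn : 1 ≤ n)
    (hu : ∀ v : Sph n, ∃ i, 0 < inner ℝ (v : Euc n) (u i : Euc n)) (hc : ∀ i, 0 < c i)
    (hφ : ClassI φ) (hG : ClassGI G)
    (hgr : ∃ c T : ℝ, 0 < c ∧ 0 < T ∧ ∀ t u, T ≤ t → c * t ^ (n - 1) ≤ G t u) :
    ∃ z : Fin m → ℝ, (∀ i, 0 < z i) ∧
      dualVol G (polarBody (hPoly u z)) ≤ dualVol G (unitBall n) ∧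
      ∀ z' : Fin m → ℝ, (∀ i, 0 < z' i) →
        dualVol G (polarBody (hPoly u z')) ≤ dualVol G (unitBall n) →
        ∑ i, c i * φ (z i) ≤ ∑ i, c i * φ (z' i) := by
  have hR : ∀ᶠ R in atTop, ∀ i, ∑ j, c j < c i * φ R := by
    rw [eventually_all]
    intro i
    filter_upwards [hφ.tendsto_atTop.eventually_gt_atTop ((∑ j, c j) / c i)] with R hR
    rwa [div_lt_iff₀' (hc i)] at hR
  obtain ⟨R, hR, hR1⟩ := (hR.and (eventually_ge_atTop 1)).exists
  choose δ hδ hδz using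
    exists_forall_lt_of_dualVol_le hu hn hG hgr R (dualVol G (unitBall n))
  have hcpt := isCompact_setOf_dualVol_le hu hG hδ R (dualVol G (unitBall n))
  set S := {z : Fin m → ℝ | z ∈ Icc δ (fun _ => R) ∧
      dualVol G (polarBody (hPoly u z)) ≤ dualVol G (unitBall n)} with hS
  have hmemS : ∀ z : Fin m → ℝ, (∀ i, 0 < z i ∧ z i ≤ R) →
      dualVol G (polarBody (hPoly u z)) ≤ dualVol G (unitBall n) → z ∈ S := fun z hz hV =>
    ⟨⟨fun i => (hδz i z hz hV).le, fun i => (hz i).2⟩, hV⟩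
  have hone : (fun _ => 1 : Fin m → ℝ) ∈ S := by
    refine hmemS _ (fun _ => ⟨one_pos, hR1⟩) ?_
    have hB := isBody_hPoly (z := fun _ => 1) hu fun _ => one_pos
    rw [dualVol_polarBody hB, dualVol_unitBall]
    refine hG.integral_mono hB.continuous_inv_supportFn hB.inv_supportFn_pos continuous_const
      fun w => inv_le_one_of_one_le₀ ?_
    have hw : (w : Euc n) ∈ hPoly u fun _ => 1 := fun i => by
      simpa [norm_coe_sph] using real_inner_le_norm (w : Euc n) (u i : Euc n)
    simpa [inner_self_sph] using inner_le_supportFn hB.1 hw w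
  have hSpos : ∀ z ∈ S, ∀ i, 0 < z i := fun z hz i => (hδ i).trans_le (hz.1.1 i)
  obtain ⟨z, hzS, hzmin⟩ := hcpt.exists_isMinOn (f := fun z => ∑ i, c i * φ (z i)) ⟨_, hone⟩
    (continuousOn_finsetSum _ fun i _ => continuousOn_const.mul
      (hφ.continuousOn.comp (continuous_apply i).continuousOn fun z hz => hSpos z hz i))
  refine ⟨z, hSpos z hzS, hzS.2, fun z' hz' hV' => ?_⟩
  by_cases hle : ∀ i, z' i ≤ R
  · exact hzmin (hmemS z' (fun i => ⟨hz' i, hle i⟩) hV')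
  · push Not at hle
    obtain ⟨i, hi⟩ := hle
    have hR0 : 0 < R := one_pos.trans_le hR1
    calc ∑ i, c i * φ (z i) ≤ ∑ i, c i * φ 1 := hzmin hone
      _ = ∑ i, c i := by simp_rw [hφ.map_one, mul_one]
      _ ≤ c i * φ R := (hR i).le
      _ ≤ c i * φ (z' i) :=
          mul_le_mul_of_nonneg_left (hφ.strictMonoOn.monotoneOn hR0 (hz' i) hi.le) (hc i).le
      _ ≤ ∑ i, c i * φ (z' i) :=
          Finset.single_le_sum (f := fun i => c i * φ (z' i))
            (fun j _ => mul_nonneg (hc j).le (hφ.pos _ (hz' j)).le) (Finset.mem_univ i)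

theorem exists_polytope_minimizer (hn : 1 ≤ n)
    (hu : ∀ v : Sph n, ∃ i, 0 < inner ℝ (v : Euc n) (u i : Euc n)) (hc : ∀ i, 0 < c i)
    (hφ : ClassI φ) (hG : ClassGI G)
    (hgr : ∃ c T : ℝ, 0 < c ∧ 0 < T ∧ ∀ t u, T ≤ t → c * t ^ (n - 1) ≤ G t u) :
    ∃ P ∈ bodiesTilde G, IsPolytope P ∧ HasFaceNormals P u ∧
      energy φ (discreteMeasure c u) P = ∑ i, c i * φ (supportFn P (u i)) ∧
      IsLeast (energy φ (discreteMeasure c u) '' bodiesTilde G)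
        (energy φ (discreteMeasure c u) P) := by
  obtain ⟨z, hz, hzV, hmin⟩ := exists_minimal_distances hn hu hc hφ hG hgr
  have hB := isBody_hPoly hu hz
  have hstrict : ∀ z' : Fin m → ℝ, (∀ i, 0 < z' i) → (∀ i, z' i ≤ z i) → (∃ i, z' i < z i) →
      dualVol G (unitBall n) < dualVol G (polarBody (hPoly u z')) := by
    rintro z' hz' hle ⟨i, hi⟩
    by_contra! hV
    refine (hmin z' hz' hV).not_gt (Finset.sum_lt_sum (fun j _ => ?_) ⟨i, Finset.mem_univ i, ?_⟩)
    · exact mul_le_mul_of_nonneg_left (hφ.strictMonoOn.monotoneOn (hz' j) (hz j) (hle j)) (hc j).le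
    · exact mul_lt_mul_of_pos_left (hφ.strictMonoOn (hz' i) (hz i) hi) (hc i)
  have hsupp_le : ∀ i, supportFn (hPoly u z) (u i) ≤ z i := fun i =>
    supportFn_le ⟨0, hB.zero_mem⟩ fun x hx => hx i
  have hsupp : ∀ i, supportFn (hPoly u z) (u i) = z i := by
    by_contra! hne
    obtain ⟨i, hi⟩ := hne
    have heq : hPoly u (fun i => supportFn (hPoly u z) (u i)) = hPoly u z :=
      (hPoly_mono hsupp_le).antisymm fun x hx i => inner_le_supportFn hB.1 hx (u i)
    have := hstrict _ (fun i => hB.supportFn_pos (u i)) hsupp_le ⟨i, (hsupp_le i).lt_of_ne hi⟩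
    rw [heq] at this
    exact this.not_ge hzV
  have hV : dualVol G (polarBody (hPoly u z)) = dualVol G (unitBall n) := by
    refine hzV.antisymm ?_
    refine ge_of_tendsto ((tendsto_dualVol_polarBody_hPoly_smul hu hG hz).mono_left
      (nhdsWithin_le_nhds (s := Iio 1))) ?_
    filter_upwards [Ioo_mem_nhdsLT (zero_lt_one (α := ℝ))] with t ht
    obtain ⟨i, -⟩ := hu (nonempty_sph hn).some
    have hlt : ∀ i, (t • z) i < z i := fun i => mul_lt_of_lt_one_left (hz i) ht.2
    exact (hstrict _ (fun i => mul_pos ht.1 (hz i)) (fun i => (hlt i).le) ⟨i, hlt i⟩).le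
  refine ⟨hPoly u z, ⟨hB, hV⟩, isPolytope_hPoly hu, hasFaceNormals_hPoly hu hz hsupp,
    energy_discreteMeasure hc φ _, mem_image_of_mem _ ⟨hB, hV⟩, ?_⟩
  rintro _ ⟨Q, ⟨hQ, hQV⟩, rfl⟩
  simp_rw [energy_discreteMeasure hc, hsupp]
  refine hmin _ (fun i => hQ.supportFn_pos (u i)) ?_
  rw [← hQV]
  exact dualVol_polarBody_anti hG hQ (isBody_hPoly hu fun i => hQ.supportFn_pos (u i))
    fun x hx i => inner_le_supportFn hQ.1 hx (u i)

end Minimizer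

section HomogeneousDualVolume

variable {n : ℕ} {G : ℝ → Sph n → ℝ} {K : Set (Euc n)}

lemma homDualVol_eq_iff (hn : 1 ≤ n) (hG : ClassGI G) (hρ : Continuous (radialFn K))
    (hpos : ∀ w, 0 < radialFn K w) :
    0 < homDualVol G K ∧ ∀ η, 0 < η →
      (homDualVol G K = η ↔ ∫ w, G (radialFn K w / η) w ∂(sphMeasure n) = 1) := by
  obtain ⟨s, hs, h⟩ := hG.exists_integral_mul_le_one_iff hn hρ hpos
  have hset : {η : ℝ | 0 < η ∧ ∫ w, G (radialFn K w / η) w ∂(sphMeasure n) ≤ 1} = Ici s⁻¹ := by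
    ext η
    simp_rw [mem_ofPred_eq, mem_Ici, div_eq_inv_mul]
    constructor
    · rintro ⟨hη, hle⟩
      exact (inv_le_comm₀ hη hs).1 ((h _ (inv_pos.2 hη)).1.1 hle)
    · intro hle
      have hη := (inv_pos.2 hs).trans_le hle
      exact ⟨hη, (h _ (inv_pos.2 hη)).1.2 ((inv_le_comm₀ hs hη).1 hle)⟩
  rw [homDualVol, hset, csInf_Ici]
  refine ⟨inv_pos.2 hs, fun η hη => ?_⟩
  simp_rw [div_eq_inv_mul]
  rw [(h _ (inv_pos.2 hη)).2, inv_eq_iff_eq_inv, eq_comm]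

lemma bodiesHat_eq_bodiesTilde (hn : 1 ≤ n) (hG : ClassGI G) :
    0 < homDualVol G (unitBall n) ∧
      bodiesHat G = bodiesTilde fun t w => G (t / homDualVol G (unitBall n)) w := by
  have hball : radialFn (unitBall n) = fun _ => 1 := funext radialFn_unitBall
  obtain ⟨hpos, hiff⟩ := homDualVol_eq_iff (K := unitBall n) hn hG
    (by rw [hball]; exact continuous_const) (by simp [hball])
  refine ⟨hpos, ?_⟩
  have h1 := (hiff _ hpos).1 rfl
  ext Q
  refine and_congr_right fun hQ => ?_
  have hrad : radialFn (polarBody Q) = fun w => (supportFn Q w)⁻¹ :=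
    funext (radialFn_polarBody hQ)
  rw [(homDualVol_eq_iff (K := polarBody Q) hn hG (by rw [hrad]; exact hQ.continuous_inv_supportFn)
    (by rw [hrad]; exact hQ.inv_supportFn_pos)).2 _ hpos, dualVol, dualVol, h1]

lemma ClassGI.comp_div (hG : ClassGI G) {η : ℝ} (hη : 0 < η) :
    ClassGI fun t w => G (t / η) w where
  pos t w ht := hG.pos _ w (div_pos ht hη)
  continuousOn := hG.continuousOn.comp (f := fun p : ℝ × Sph n => (p.1 / η, p.2))
    (by fun_prop) fun p hp => ⟨div_pos hp.1 hη, mem_univ _⟩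
  strictMonoOn w := fun s hs t ht hst => hG.strictMonoOn w (div_pos hs hη) (div_pos ht hη)
    (div_lt_div_of_pos_right hst hη)
  tendsto_zero w := by
    refine (hG.tendsto_zero w).comp (tendsto_nhdsWithin_iff.2 ⟨?_, ?_⟩)
    · have : Tendsto (fun t : ℝ => t / η) (𝓝 0) (𝓝 (0 / η)) := tendsto_id.div_const η
      rw [zero_div] at this
      exact this.mono_left nhdsWithin_le_nhds
    · filter_upwards [self_mem_nhdsWithin] with t ht
      exact div_pos ht hη
  tendsto_atTop w := (hG.tendsto_atTop w).comp (tendsto_id.atTop_div_const hη)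

lemma HasGrowth.exists_mul_pow_le {q : ℝ} (h : HasGrowth G q) (hn : 1 ≤ n)
    (hq : (n : ℝ) - 1 ≤ q) {η : ℝ} (hη : 0 < η) :
    ∃ c T : ℝ, 0 < c ∧ 0 < T ∧ ∀ t u, T ≤ t → c * t ^ (n - 1) ≤ G (t / η) u := by
  obtain ⟨c, hc, hle⟩ := h
  refine ⟨c / η ^ (n - 1), η, by positivity, hη, fun t w ht => ?_⟩
  have h1 : 1 ≤ t / η := (one_le_div hη).2 ht
  have h0 : 0 < t / η := one_pos.trans_le h1
  have h2 := hle _ w h1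
  rw [le_div_iff₀ (Real.rpow_pos_of_pos h0 q)] at h2
  calc c / η ^ (n - 1) * t ^ (n - 1) = c * (t / η) ^ (n - 1) := by rw [div_pow]; ring
    _ = c * (t / η) ^ ((n : ℝ) - 1) := by
        rw [← Real.rpow_natCast, Nat.cast_sub hn, Nat.cast_one]
    _ ≤ c * (t / η) ^ q :=
        mul_le_mul_of_nonneg_left (Real.rpow_le_rpow_of_exponent_le h1 hq) hc.le
    _ ≤ _ := h2

end HomogeneousDualVolume

end DualPolarOrlicz

end

theorem mainTheorem4 (n m : ℕ) (hn : 1 ≤ n)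
    (c : Fin m → ℝ) (hc : ∀ i, 0 < c i) (u : Fin m → DualPolarOrlicz.Sph n)
    (μ : MeasureTheory.Measure (DualPolarOrlicz.Sph n))
    (hμ : μ = DualPolarOrlicz.discreteMeasure c u)
    (hconc : DualPolarOrlicz.NotConcentrated μ)
    (φ : ℝ → ℝ) (hφ : DualPolarOrlicz.ClassI φ)
    (G : ℝ → DualPolarOrlicz.Sph n → ℝ) (hG : DualPolarOrlicz.ClassGI G)
    (q : ℝ) (hq : (n : ℝ) - 1 ≤ q) (hgrowth : DualPolarOrlicz.HasGrowth G q) :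
    (∃ P ∈ DualPolarOrlicz.bodiesTilde G,
      DualPolarOrlicz.IsPolytope P ∧ DualPolarOrlicz.HasFaceNormals P u ∧
      DualPolarOrlicz.energy φ μ P = ∑ i, c i * φ (DualPolarOrlicz.supportFn P (u i)) ∧
      IsLeast (DualPolarOrlicz.energy φ μ '' DualPolarOrlicz.bodiesTilde G)
        (DualPolarOrlicz.energy φ μ P)) ∧
    (∃ P ∈ DualPolarOrlicz.bodiesHat G,
      DualPolarOrlicz.IsPolytope P ∧ DualPolarOrlicz.HasFaceNormals P u ∧
      DualPolarOrlicz.energy φ μ P = ∑ i, c i * φ (DualPolarOrlicz.supportFn P (u i)) ∧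
      IsLeast (DualPolarOrlicz.energy φ μ '' DualPolarOrlicz.bodiesHat G)
        (DualPolarOrlicz.energy φ μ P)) := by
  subst hμ
  have hu := fun v => hconc.exists_inner_pos v
  refine ⟨DualPolarOrlicz.exists_polytope_minimizer hn hu hc hφ hG ?_, ?_⟩
  · simpa only [div_one] using hgrowth.exists_mul_pow_le hn hq one_pos
  · obtain ⟨hη, heq⟩ := DualPolarOrlicz.bodiesHat_eq_bodiesTilde hn hG
    rw [heq]
    exact DualPolarOrlicz.exists_polytope_minimizer hn hu hc hφ (hG.comp_div hη)
      (hgrowth.exists_mul_pow_le hn hq hη)
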